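/- Let $G=(V,E)$ be a finite simple graph on $n$ vertices with adjacency matrix $\mathbf A$ in which every vertex lies in a triangle (for instance a triangular lattice graph), and let $\epsilon>0$. A triangle is a set of three pairwise adjacent vertices; $1_v$ denotes the bit string whose only nonzero entry is at $v$. For operators $M_v$ on the $v$-th tensor factor and $x\in\mathbb{Z}_{\ge 0}^{V}$ write $M^x=\bigotimes_{v} M_v^{x_v}$. Let $|\psi'\rangle$ be a unit vector in a tensor product $\bigotimes_{v\in V}\mathcal H_v$ of complex Hilbert spaces of arbitrary dimension, and for each $v$ let $X'_v$, $Z'_v$ be $\pm1$-valued observables on $\mathcal H_v$ (bounded self-adjoint operators with square $I$). Suppose that for each $v\in V$ $$\langle\psi'|S'_v|\psi'\rangle\ge 1-\epsilon,\qquad S'_v=X'_v\,Z'^{\mathbf A 1_v},$$ and that for each triangle $T\subseteq V$ with characteristic vector $\tau$ $$-\langle\psi'|X'^{\tau}Z'^{\mathbf A\tau}|\psi'\rangle\ge 1-\epsilon .$$ Then there exist Hilbert spaces $\mathcal K_v$, a local isometry $\Phi=\bigotimes_{v}\Phi_v$ with isometries $\Phi_v:\mathcal H_v\to\mathcal K_v\otimes\mathbb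 C^2$, and a unit vector $|junk\rangle\in\bigotimes_v\mathcal K_v$ such that for all $p,q\in\{0,1\}^V$ $$\left\|\Phi\left(X'^{q}Z'^{p}|\psi'\rangle\right)-|junk\rangle\otimes X^{q}Z^{p}|G\rangle\right\|\le\left(2\sqrt{p\cdot p}+2\sqrt{2n}+\sqrt{|E|+n}\right)(2\epsilon)^{1/4}.$$ Here $X,Z$ are the Pauli matrices, $p\cdot p$ is the number of ones in $p$, and $|G\rangle=2^{-n/2}\sum_{x\in\{0,1\}^V}(-1)^{\frac12 x\cdot\mathbf A x}|x\rangle$ (with $x\cdot\mathbf A x$ evaluated in $\mathbb Z$) is the graph state of $G$, with one qubit $\mathbb C^2$ for each vertex. -/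

import Mathlib

open scoped BigOperators InnerProductSpace Matrix

universe u v

noncomputable section

namespace GraphStateTest

/-- The Hilbert space `ℓ²(ι)` with its standard orthonormal basis indexed by `ι`.  Every complex
Hilbert space (of any dimension) is of this form once an orthonormal basis is fixed. -/
abbrev Hilb (ι : Type*) : Type _ := lp (fun _ : ι => ℂ) 2

/-! ### Tensor products

The Hilbert space tensor product of the `Hilb (ι v)`, `v ∈ V`, is `Hilb (∀ v, ι v)`: the standard
basis vector with index `x` is the tensor product of the standard basis vectors with indices
`x v`. -/

section Tensor

variable {V : Type*} [Fintype V]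

lemma prod_memℓp {ι : V → Type*} (a : ∀ v, Hilb (ι v)) :
    Memℓp (fun x : ∀ v, ι v => ∏ v, a v (x v)) 2 := by
  classical
  refine memℓp_gen' (C := ∏ v, ∑' i, ‖a v i‖ ^ (2 : ENNReal).toReal) fun s => ?_
  have hs : s ⊆ Fintype.piFinset fun v => s.image fun x => x v := by
    intro x hx
    rw [Fintype.mem_piFinset]
    exact fun v => Finset.mem_image_of_mem _ hx
  calc ∑ x ∈ s, ‖∏ v, a v (x v)‖ ^ (2 : ENNReal).toReal
      ≤ ∑ x ∈ Fintype.piFinset fun v => s.image fun x => x v,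
          ‖∏ v, a v (x v)‖ ^ (2 : ENNReal).toReal :=
        Finset.sum_le_sum_of_subset_of_nonneg hs fun _ _ _ => by positivity
    _ = ∏ v, ∑ i ∈ s.image fun x => x v, ‖a v i‖ ^ (2 : ENNReal).toReal := by
        rw [Finset.prod_univ_sum]
        refine Finset.sum_congr rfl fun x _ => ?_
        rw [norm_prod, Real.finsetProd_rpow _ _ fun _ _ => norm_nonneg _]
    _ ≤ _ := by
        refine Finset.prod_le_prod (fun _ _ => Finset.sum_nonneg fun _ _ => by positivity)
          fun v _ => ?_
        exact ((memℓp_gen_iff (by simp)).1 (lp.memℓp (a v))).sum_le_tsum _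
          fun _ _ => by positivity

/-- The product vector `⨂ᵥ aᵥ`. -/
def productVector {ι : V → Type*} (a : ∀ v, Hilb (ι v)) : Hilb (∀ v, ι v) :=
  ⟨fun x => ∏ v, a v (x v), prod_memℓp a⟩

lemma inner_productVector {ι : V → Type*} (a b : ∀ v, Hilb (ι v)) :
    ⟪productVector a, productVector b⟫_ℂ = ∏ v, ⟪a v, b v⟫_ℂ := by
  classical
  have h1 := lp.hasSum_inner (𝕜 := ℂ) (productVector a) (productVector b)
  have h2 : Filter.Tendsto (fun s : ∀ v, Finset (ι v) => ∏ v, ∑ i ∈ s v, ⟪a v i, b v i⟫_ℂ)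
      Filter.atTop (nhds (∏ v, ⟪a v, b v⟫_ℂ)) := by
    refine tendsto_finsetProd _ fun v _ => ?_
    have h := lp.hasSum_inner (𝕜 := ℂ) (a v) (b v)
    rw [HasSum, SummationFilter.unconditional_filter] at h
    refine Filter.Tendsto.comp (g := fun s => ∑ i ∈ s, ⟪a v i, b v i⟫_ℂ) h ?_
    exact Filter.tendsto_atTop_atTop.2 fun s =>
      ⟨Function.update (fun _ => ∅) v s, fun t ht => by simpa using ht v⟩
  have h3 : Filter.Tendsto (fun s : ∀ v, Finset (ι v) => Fintype.piFinset s)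
      Filter.atTop Filter.atTop := by
    refine Filter.tendsto_atTop_finset_of_monotone
      (fun s t h => Fintype.piFinset_subset _ _ h) fun x => ⟨fun v => {x v}, ?_⟩
    simp
  refine tendsto_nhds_unique (h1.comp h3) (h2.congr fun s => ?_)
  rw [Finset.prod_univ_sum]
  refine Finset.sum_congr rfl fun x _ => ?_
  simp [productVector, Finset.prod_mul_distrib]

/-- The standard basis vector of `Hilb ι` with index `i`. -/
def ket {ι : Type*} (i : ι) : Hilb ι := by
  classical
  exact lp.single 2 i 1

lemma inner_ket {ι : Type*} (i j : ι) [Decidable (i = j)] :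
    ⟪ket i, ket j⟫_ℂ = if i = j then 1 else 0 := by
  classical
  unfold ket
  rw [lp.inner_single_left]
  by_cases h : i = j
  · subst h; simp
  · simp [h]

lemma orthonormal_productVector {ι κ : V → Type*} (Φ : ∀ v, Hilb (ι v) →ₗᵢ[ℂ] Hilb (κ v)) :
    Orthonormal ℂ fun x : ∀ v, ι v => productVector fun v => Φ v (ket (x v)) := by
  classical
  rw [orthonormal_iff_ite]
  intro x y
  rw [inner_productVector]
  simp only [LinearIsometry.inner_map_map, inner_ket]
  by_cases h : x = y
  · subst h; simp
  · obtain ⟨v, hv⟩ := Function.ne_iff.1 h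
    rw [if_neg h]
    exact Finset.prod_eq_zero (Finset.mem_univ v) (if_neg hv)

/-- The tensor product `⨂ᵥ Φᵥ` of isometries `Φᵥ : Hilb (ι v) → Hilb (κ v)`: the isometry that
sends each product basis vector `⨂ᵥ |xᵥ⟩` to `⨂ᵥ Φᵥ |xᵥ⟩`, extended linearly and
continuously.  The isometries of this form are the local isometries. -/
def tensorIsometry {ι κ : V → Type*} (Φ : ∀ v, Hilb (ι v) →ₗᵢ[ℂ] Hilb (κ v)) :
    Hilb (∀ v, ι v) →ₗᵢ[ℂ] Hilb (∀ v, κ v) :=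
  (orthonormal_productVector Φ).orthogonalFamily.linearIsometry

lemma tensorIsometry_productVector {ι κ : V → Type*} (Φ : ∀ v, Hilb (ι v) →ₗᵢ[ℂ] Hilb (κ v))
    (a : ∀ v, Hilb (ι v)) :
    tensorIsometry Φ (productVector a) = productVector fun v => Φ v (a v) := by
  classical
  set f := productVector a with hf
  set g := productVector fun v => Φ v (a v) with hg
  have hket : ∀ v i, ⟪ket i, a v⟫_ℂ = a v i := fun v i => by
    unfold ket
    rw [lp.inner_single_left]
    simp
  have hgg : ⟪g, g⟫_ℂ = ⟪f, f⟫_ℂ := by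
    simp only [hf, hg, inner_productVector, LinearIsometry.inner_map_map]
  have hgT : ⟪g, tensorIsometry Φ f⟫_ℂ = ⟪f, f⟫_ℂ := by
    have h := ((orthonormal_productVector Φ).orthogonalFamily.hasSum_linearIsometry f).mapL
      (innerSL ℂ g)
    refine h.unique ?_
    convert lp.hasSum_inner (𝕜 := ℂ) f f using 2 with x
    have : ⟪g, productVector fun v => Φ v (ket (x v))⟫_ℂ = starRingEnd ℂ (f x) := by
      rw [hg, inner_productVector, hf]
      simp only [LinearIsometry.inner_map_map, productVector, map_prod]
      exact Finset.prod_congr rfl fun v _ => by rw [← hket, inner_conj_symm]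
    simp [this, Complex.mul_conj']
  have h0 : ⟪tensorIsometry Φ f - g, tensorIsometry Φ f - g⟫_ℂ = 0 := by
    have hTg : ⟪tensorIsometry Φ f, g⟫_ℂ = ⟪f, f⟫_ℂ := by
      rw [← inner_conj_symm, hgT, inner_conj_symm]
    simp only [inner_sub_left, inner_sub_right, hgg, hgT, hTg, LinearIsometry.inner_map_map]
    ring
  exact sub_eq_zero.1 (inner_self_eq_zero.1 h0)

end Tensor

lemma tensor_memℓp {V : Type*} {κ μ : V → Type*} (a : Hilb (∀ v, κ v)) (b : Hilb (∀ v, μ v)) :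
    Memℓp (fun x : ∀ v, κ v × μ v => a (fun v => (x v).1) * b (fun v => (x v).2)) 2 := by
  refine memℓp_gen ?_
  have ha := (memℓp_gen_iff (by simp)).1 (lp.memℓp a)
  have hb := (memℓp_gen_iff (by simp)).1 (lp.memℓp b)
  have h := ha.mul_of_nonneg hb (fun _ => by positivity) (fun _ => by positivity)
  let e : (∀ v, κ v × μ v) ≃ (∀ v, κ v) × (∀ v, μ v) :=
    { toFun := fun x => (fun v => (x v).1, fun v => (x v).2)
      invFun := fun y v => (y.1 v, y.2 v)
      left_inv := fun _ => rfl
      right_inv := fun _ => rfl }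
  refine (e.summable_iff.2 h).congr fun x => ?_
  simp [e, mul_pow]

/-- The tensor product `a ⊗ b` of two `V`-partite vectors, regarded as a `V`-partite vector whose
subsystem `v` consists of the subsystems `v` of `a` and of `b`. -/
def tensorState {V : Type*} {κ μ : V → Type*} (a : Hilb (∀ v, κ v)) (b : Hilb (∀ v, μ v)) :
    Hilb (∀ v, κ v × μ v) :=
  ⟨fun x => a (fun v => (x v).1) * b (fun v => (x v).2), tensor_memℓp a b⟩

/-! ### Observables -/

/-- An observable with outcomes `±1`: a bounded self-adjoint operator whose square is the
identity. -/
structure PMObservable (ι : Type*) where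
  op : Hilb ι →L[ℂ] Hilb ι
  symmetric : ∀ x y, ⟪op x, y⟫_ℂ = ⟪x, op y⟫_ℂ
  involutive : ∀ x, op (op x) = x

/-- A `±1` observable is unitary; here it is regarded as an isometry. -/
def PMObservable.toIsometry {ι : Type*} (M : PMObservable ι) : Hilb ι →ₗᵢ[ℂ] Hilb ι :=
  M.op.toLinearMap.isometryOfInner fun x y => by
    change ⟪M.op x, M.op y⟫_ℂ = _
    rw [M.symmetric, M.involutive]

/-- `M^x = ⨂ᵥ Mᵥ^{xᵥ}` for `±1` observables `Mᵥ` on the subsystems and exponents `xᵥ`. -/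
def opPow {V : Type*} [Fintype V] {ι : V → Type*} (M : ∀ v, PMObservable (ι v)) (x : V → ℕ) :
    Hilb (∀ v, ι v) →ₗᵢ[ℂ] Hilb (∀ v, ι v) :=
  tensorIsometry fun v => (M v).toIsometry ^ x v

/-! ### Qubits -/

lemma matrix_inner (M : Matrix (Fin 2) (Fin 2) ℂ) (hM : Mᴴ = M) (a b : Hilb (Fin 2)) :
    ∑ i, ⟪∑ j, M i j * a j, b i⟫_ℂ = ∑ i, ⟪a i, ∑ j, M i j * b j⟫_ℂ := by
  have h : ∀ i j, star (M j i) = M i j := fun i j => congrFun (congrFun hM i) j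
  simp only [Complex.star_def] at h
  simp only [Fin.sum_univ_two, RCLike.inner_apply, map_add, map_mul, h]
  ring

/-- The `±1` observable on a qubit given by a Hermitian `2 × 2` matrix with square `1`. -/
def qubitObservable (M : Matrix (Fin 2) (Fin 2) ℂ) (hM : Mᴴ = M) (hM2 : M * M = 1) :
    PMObservable (Fin 2) where
  op := (lpPiLpₗᵢ (fun _ : Fin 2 => ℂ) ℂ).symm.toContinuousLinearEquiv.toContinuousLinearMap ∘L
    Matrix.toEuclideanCLM (𝕜 := ℂ) M ∘L
    (lpPiLpₗᵢ (fun _ : Fin 2 => ℂ) ℂ).toContinuousLinearEquiv.toContinuousLinearMap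
  symmetric x y := by
    rw [lp.inner_eq_tsum, lp.inner_eq_tsum, tsum_fintype, tsum_fintype]
    exact matrix_inner M hM x y
  involutive x := by
    have h : ∀ y, Matrix.toEuclideanCLM (𝕜 := ℂ) M (Matrix.toEuclideanCLM (𝕜 := ℂ) M y) = y := by
      intro y
      rw [← mul_apply_eq_comp, ← map_mul, hM2, map_one, one_apply_eq_self]
    simp [h]

/-- The Pauli observable `X`. -/
def pauliX : PMObservable (Fin 2) :=
  qubitObservable !![0, 1; 1, 0] (by ext i j; fin_cases i <;> fin_cases j <;> simp)
    (by simp [Matrix.one_fin_two])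

/-- The Pauli observable `Z`. -/
def pauliZ : PMObservable (Fin 2) :=
  qubitObservable !![1, 0; 0, -1] (by ext i j; fin_cases i <;> fin_cases j <;> simp)
    (by simp [Matrix.one_fin_two])

/-! ### Graph states -/

/-- The bits of a bit string, as integers. -/
def bits {V : Type*} (x : V → Fin 2) : V → ℕ := fun v => (x v : ℕ)

section Graph

variable {V : Type*} [Fintype V] [DecidableEq V] (G : SimpleGraph V) [DecidableRel G.Adj]

/-- The graph state `2^{-n/2} ∑ₓ (-1)^{(x · A x) / 2} |x⟩`, with `x · A x` (an even number)
evaluated in the integers. -/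
def graphState : Hilb (V → Fin 2) :=
  ⟨fun x => ((Real.sqrt (2 ^ Fintype.card V))⁻¹ : ℂ) *
    (-1) ^ ((bits x ⬝ᵥ (G.adjMatrix ℕ *ᵥ bits x)) / 2), Memℓp.all _⟩

/-- The stabilizer `S_v = X_v Z^{A 1_v}`. -/
def stabilizer {ι : V → Type*} (X Z : ∀ v, PMObservable (ι v)) (v : V) :
    Hilb (∀ v, ι v) →ₗᵢ[ℂ] Hilb (∀ v, ι v) :=
  opPow X (Pi.single v 1) * opPow Z (G.adjMatrix ℕ *ᵥ Pi.single v 1)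

/-- The operator `X^τ Z^{A τ}`, where `τ` is the characteristic vector of `T`. -/
def triangleOp {ι : V → Type*} (X Z : ∀ v, PMObservable (ι v)) (T : Finset V) :
    Hilb (∀ v, ι v) →ₗᵢ[ℂ] Hilb (∀ v, ι v) :=
  opPow X (fun v => if v ∈ T then 1 else 0) *
    opPow Z (G.adjMatrix ℕ *ᵥ fun v => if v ∈ T then 1 else 0)

end Graph

end GraphStateTest

end

open GraphStateTest

open GraphStateTest

namespace GraphStateTest

/-! ### Continuous linear maps on `ℓ²` and tensor products of isometries -/

/-! At each vertex the isometry is the usual swap circuit: it sends the +1 eigenspace of `Z'` to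
`|0⟩` and the -1 eigenspace, moved by `X'`, to `|1⟩`. It carries `Z'` to Pauli `Z` exactly. Its
failure to carry `X'` to Pauli `X` is an isometry applied to the anticommutator of `X'` and `Z'`,
divided by `√2` (`localShift_extraction_sub`). So everything rests on near anticommutation on `ψ'`.

Write `d = √(2ε)`; each hypothesis on an expectation value says that an operator moves `ψ'`, up to
sign, by at most `d`. For a triangle `v, u, w` the product of its three stabilizers is the triangle
operator conjugated by `Z_v`. The product nearly fixes `ψ'` and the triangle operator nearly negates
it, so the anticommutator at `v` has norm at most `3d + d = 4d` on `ψ'` (`norm_anticommutator_le`).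

Hence the extracted vector is fixed by each true stabilizer up to `η = (2√2 + 1)d`. The diagonal
graph phase turns these stabilizers into bit flips; averaging over all flips and normalising gives
`junk ⊗ |G⟩` within `nη` (`exists_tensorState_graphState_near`). Moving `X'^q` through the isometry
costs at most another `2√2 n d`, while `Z'^p` is free.

The error `e` is thus at most `n(1 + 4√2)d`, and also at most 2 as a difference of unit vectors.
From `e² ≤ 2e` comes a bound in `√n (2ε)^(1/4)`, which lies below the stated one
(`le_self_test_bound`). -/

lemma ket_apply {ι : Type*} (i j : ι) [Decidable (j = i)] :
    ket i j = if j = i then 1 else 0 := by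
  classical
  unfold ket
  rw [lp.single_apply]
  by_cases h : j = i
  · subst h; simp
  · simp [h]

/-- Finite combinations of kets are dense. Every identity between tensor products of isometries
below is thereby reduced to product basis vectors. -/
lemma continuousLinearMap_ext_ket {ι F : Type*} [NormedAddCommGroup F] [NormedSpace ℂ F]
    {f g : Hilb ι →L[ℂ] F} (h : ∀ i, f (ket i) = g (ket i)) : f = g := by
  classical
  ext a
  have ha := lp.hasSum_single (E := fun _ : ι => ℂ) (p := 2) (by simp) a
  have hk : ∀ i, lp.single (E := fun _ : ι => ℂ) 2 i (a i) = a i • ket i := fun i => by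
    ext j
    rw [lp.coeFn_smul, Pi.smul_apply, ket_apply, lp.single_apply]
    by_cases h : j = i
    · subst h; simp
    · simp [h]
  simp only [hk] at ha
  have h1 := ha.mapL f
  have h2 := ha.mapL g
  simp only [map_smul, h] at h1 h2
  exact h1.unique h2

section Tensor

variable {V : Type*} [Fintype V]

lemma productVector_apply {ι : V → Type*} (a : ∀ v, Hilb (ι v)) (x : ∀ v, ι v) :
    productVector a x = ∏ v, a v (x v) := rfl

lemma productVector_ket {ι : V → Type*} (x : ∀ v, ι v) :
    productVector (fun v => ket (x v)) = ket x := by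
  classical
  ext y
  simp only [productVector_apply, ket_apply]
  by_cases h : y = x
  · subst h; simp
  · obtain ⟨v, hv⟩ := Function.ne_iff.1 h
    rw [if_neg h]
    exact Finset.prod_eq_zero (Finset.mem_univ v) (if_neg hv)

lemma tensorIsometry_ket {ι κ : V → Type*} (Φ : ∀ v, Hilb (ι v) →ₗᵢ[ℂ] Hilb (κ v))
    (x : ∀ v, ι v) :
    tensorIsometry Φ (ket x) = productVector fun v => Φ v (ket (x v)) := by
  rw [← productVector_ket, tensorIsometry_productVector]

lemma tensorIsometry_comp {ι κ μ : V → Type*} (Φ : ∀ v, Hilb (κ v) →ₗᵢ[ℂ] Hilb (μ v))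
    (Ψ : ∀ v, Hilb (ι v) →ₗᵢ[ℂ] Hilb (κ v)) (φ : Hilb (∀ v, ι v)) :
    tensorIsometry Φ (tensorIsometry Ψ φ) = tensorIsometry (fun v => (Φ v).comp (Ψ v)) φ := by
  have h : (tensorIsometry Φ).toContinuousLinearMap.comp (tensorIsometry Ψ).toContinuousLinearMap
      = (tensorIsometry fun v => (Φ v).comp (Ψ v)).toContinuousLinearMap := by
    refine continuousLinearMap_ext_ket fun x => ?_
    simp [tensorIsometry_ket, tensorIsometry_productVector]
  exact DFunLike.congr_fun h φ

lemma tensorIsometry_mul {ι : V → Type*} (Φ Ψ : ∀ v, Hilb (ι v) →ₗᵢ[ℂ] Hilb (ι v)) :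
    tensorIsometry Φ * tensorIsometry Ψ = tensorIsometry fun v => Φ v * Ψ v :=
  LinearIsometry.ext fun φ => tensorIsometry_comp Φ Ψ φ

lemma tensorIsometry_one {ι : V → Type*} :
    tensorIsometry (fun v => (1 : Hilb (ι v) →ₗᵢ[ℂ] Hilb (ι v))) = 1 := by
  have h : (tensorIsometry fun v => (1 : Hilb (ι v) →ₗᵢ[ℂ] Hilb (ι v))).toContinuousLinearMap
      = ContinuousLinearMap.id ℂ _ := by
    refine continuousLinearMap_ext_ket fun x => ?_
    simp [tensorIsometry_ket, productVector_ket]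
  exact LinearIsometry.ext fun φ => DFunLike.congr_fun h φ

/-- If each `F v` is a weighted reindexing of `Φ v`, then so is the tensor product. -/
lemma tensorIsometry_reindex {ι κ μ : V → Type*} (Φ : ∀ v, Hilb (ι v) →ₗᵢ[ℂ] Hilb (κ v))
    (F : ∀ v, Hilb (ι v) →ₗᵢ[ℂ] Hilb (μ v)) (s : ∀ v, μ v → ℂ) (σ : ∀ v, μ v → κ v)
    (h : ∀ v a j, F v a j = s v j * Φ v a (σ v j)) (φ : Hilb (∀ v, ι v)) (j : ∀ v, μ v) :
    tensorIsometry F φ j = (∏ v, s v (j v)) * tensorIsometry Φ φ fun v => σ v (j v) := by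
  have h : (lp.evalCLM ℂ (fun _ : ∀ v, μ v => ℂ) 2 j).comp
      (tensorIsometry F).toContinuousLinearMap =
      (∏ v, s v (j v)) • (lp.evalCLM ℂ (fun _ : ∀ v, κ v => ℂ) 2 fun v => σ v (j v)).comp
        (tensorIsometry Φ).toContinuousLinearMap := by
    refine continuousLinearMap_ext_ket fun x => ?_
    simp [tensorIsometry_ket, lp.evalCLM, productVector_apply, h, Finset.prod_mul_distrib]
  exact DFunLike.congr_fun h φ

/-- A linear relation between isometries of one subsystem passes to the tensor products. -/
lemma tensorIsometry_sub_eq_smul_add {ι κ : V → Type*} (v : V)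
    (F₁ F₂ F₃ F₄ : ∀ v, Hilb (ι v) →ₗᵢ[ℂ] Hilb (κ v)) (c : ℂ)
    (h₁ : ∀ u, u ≠ v → F₁ u = F₄ u) (h₂ : ∀ u, u ≠ v → F₂ u = F₄ u)
    (h₃ : ∀ u, u ≠ v → F₃ u = F₄ u)
    (h : ∀ a, F₁ v a - F₂ v a = c • (F₃ v a + F₄ v a)) (φ : Hilb (∀ v, ι v)) :
    tensorIsometry F₁ φ - tensorIsometry F₂ φ =
      c • (tensorIsometry F₃ φ + tensorIsometry F₄ φ) := by
  classical
  have key : (tensorIsometry F₁).toContinuousLinearMap - (tensorIsometry F₂).toContinuousLinearMap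
      = c • ((tensorIsometry F₃).toContinuousLinearMap +
        (tensorIsometry F₄).toContinuousLinearMap) := by
    refine continuousLinearMap_ext_ket fun x => ?_
    ext j
    have hp : ∀ F : ∀ v, Hilb (ι v) →ₗᵢ[ℂ] Hilb (κ v), (∀ u, u ≠ v → F u = F₄ u) →
        tensorIsometry F (ket x) j = F v (ket (x v)) (j v) *
          ∏ u ∈ Finset.univ.erase v, F₄ u (ket (x u)) (j u) := fun F hF => by
      rw [tensorIsometry_ket, productVector_apply, ← Finset.mul_prod_erase _ _ (Finset.mem_univ v)]
      congr 1
      exact Finset.prod_congr rfl fun u hu => by rw [hF u (Finset.ne_of_mem_erase hu)]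
    have hj := congrArg (fun f : Hilb (κ v) => f (j v)) (h (ket (x v)))
    simp only [lp.coeFn_sub, lp.coeFn_smul, lp.coeFn_add, Pi.sub_apply, Pi.smul_apply,
      Pi.add_apply, smul_eq_mul] at hj
    simp only [_root_.sub_apply, _root_.add_apply, _root_.smul_apply,
      LinearIsometry.coe_toContinuousLinearMap,
      lp.coeFn_sub, lp.coeFn_smul, lp.coeFn_add, Pi.sub_apply, Pi.smul_apply,
      Pi.add_apply, smul_eq_mul, hp F₁ h₁, hp F₂ h₂, hp F₃ h₃, hp F₄ fun _ _ => rfl]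
    rw [← sub_mul, hj]
    ring
  exact DFunLike.congr_fun key φ

end Tensor

/-! ### Powers of observables -/

section OpPow

variable {V : Type*} [Fintype V] {ι : V → Type*}

lemma PMObservable.toIsometry_mul_self {ι : Type*} (M : PMObservable ι) :
    M.toIsometry * M.toIsometry = 1 :=
  LinearIsometry.ext M.involutive

lemma opPow_zero (M : ∀ v, PMObservable (ι v)) : opPow M 0 = 1 := by
  simp [opPow, tensorIsometry_one]

lemma opPow_add (M : ∀ v, PMObservable (ι v)) (x y : V → ℕ) :
    opPow M (x + y) = opPow M x * opPow M y := by
  simp [opPow, tensorIsometry_mul, pow_add]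

lemma opPow_commute (M : ∀ v, PMObservable (ι v)) (x y : V → ℕ) :
    Commute (opPow M x) (opPow M y) := by
  rw [Commute, SemiconjBy, ← opPow_add, add_comm, opPow_add]

lemma opPow_commute_of_disjoint (M N : ∀ v, PMObservable (ι v)) (x y : V → ℕ)
    (h : ∀ v, x v = 0 ∨ y v = 0) : Commute (opPow M x) (opPow N y) := by
  rw [Commute, SemiconjBy, opPow, opPow, tensorIsometry_mul, tensorIsometry_mul]
  congr 1
  funext v
  rcases h v with h | h <;> simp [h]

lemma opPow_single_mul_self [DecidableEq V] (M : ∀ v, PMObservable (ι v)) (v : V) :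
    opPow M (Pi.single v 1) * opPow M (Pi.single v 1) = 1 := by
  rw [← tensorIsometry_one, opPow, tensorIsometry_mul]
  congr 1
  funext u
  by_cases h : u = v
  · subst h; simp [PMObservable.toIsometry_mul_self]
  · simp [h]

end OpPow

/-! ### Norms on `ℓ²` -/

lemma hasSum_norm_sq {ι : Type*} (a : Hilb ι) : HasSum (fun i => ‖a i‖ ^ 2) (‖a‖ ^ 2) := by
  simpa using lp.hasSum_norm (E := fun _ : ι => ℂ) (p := 2) (by simp) a

lemma memℓp_two_of_summable {ι : Type*} {f : ι → ℂ} (h : Summable fun i => ‖f i‖ ^ 2) :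
    Memℓp f 2 :=
  memℓp_gen (by simpa using h)

/-- Multiplication by phases after a permutation of the standard basis. -/
noncomputable def monomialIsometry {J : Type*} (s : J → ℂ) (hs : ∀ j, ‖s j‖ = 1) (e : J ≃ J) :
    Hilb J →ₗᵢ[ℂ] Hilb J where
  toFun f := ⟨fun j => s j * f (e j), memℓp_two_of_summable <| by
    simpa [hs, Function.comp_def] using e.summable_iff.2 (hasSum_norm_sq f).summable⟩
  map_add' f g := by
    ext j
    exact mul_add _ _ _
  map_smul' c f := by
    ext j
    simp [mul_left_comm]
  norm_map' f := by
    refine (sq_eq_sq₀ (norm_nonneg _) (norm_nonneg _)).1 ((hasSum_norm_sq _).unique ?_)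
    simpa [hs, Function.comp_def] using e.hasSum_iff.2 (hasSum_norm_sq f)

lemma hasSum_branch {ι : Type*} (f : Fin 2 → Hilb ι) :
    HasSum (fun j : ι × Fin 2 => ‖f j.2 j.1‖ ^ 2) (‖f 0‖ ^ 2 + ‖f 1‖ ^ 2) := by
  have hs : Summable fun j : Fin 2 × ι => ‖f j.1 j.2‖ ^ 2 :=
    (summable_prod_of_nonneg fun _ => by positivity).2
      ⟨fun x => (hasSum_norm_sq (f x)).summable, Summable.of_finite⟩
  have h : HasSum (fun j : Fin 2 × ι => ‖f j.1 j.2‖ ^ 2) (‖f 0‖ ^ 2 + ‖f 1‖ ^ 2) := by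
    convert hs.hasSum using 1
    rw [hs.tsum_prod, tsum_fintype, Fin.sum_univ_two, (hasSum_norm_sq (f 0)).tsum_eq,
      (hasSum_norm_sq (f 1)).tsum_eq]
  exact (Equiv.prodComm ι (Fin 2)).hasSum_iff.2 h

/-- The isometry `a ↦ F 0 a ⊗ |0⟩ + F 1 a ⊗ |1⟩`. -/
noncomputable def branchIsometry {ι : Type*} (F : Fin 2 → Hilb ι →ₗ[ℂ] Hilb ι)
    (hF : ∀ a, ‖F 0 a‖ ^ 2 + ‖F 1 a‖ ^ 2 = ‖a‖ ^ 2) : Hilb ι →ₗᵢ[ℂ] Hilb (ι × Fin 2) where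
  toFun a := ⟨fun j => F j.2 a j.1, memℓp_two_of_summable (hasSum_branch fun x => F x a).summable⟩
  map_add' a b := by
    ext j
    simp only [map_add]
    rfl
  map_smul' c a := by
    ext j
    simp
  norm_map' a := by
    refine (sq_eq_sq₀ (norm_nonneg _) (norm_nonneg _)).1 ((hasSum_norm_sq _).unique ?_)
    rw [← hF]
    exact hasSum_branch fun x => F x a

/-! ### The tensor product of two multipartite vectors -/

lemma tensorState_apply {V : Type*} {κ μ : V → Type*} (a : Hilb (∀ v, κ v))
    (b : Hilb (∀ v, μ v)) (j : ∀ v, κ v × μ v) :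
    tensorState a b j = a (fun v => (j v).1) * b fun v => (j v).2 := rfl

lemma tensorState_sub {V : Type*} {κ μ : V → Type*} (a a' : Hilb (∀ v, κ v))
    (b : Hilb (∀ v, μ v)) : tensorState (a - a') b = tensorState a b - tensorState a' b := by
  ext j
  simp [tensorState_apply, sub_mul]

lemma norm_tensorState {V : Type*} {κ μ : V → Type*} (a : Hilb (∀ v, κ v))
    (b : Hilb (∀ v, μ v)) : ‖tensorState a b‖ = ‖a‖ * ‖b‖ := by
  refine (sq_eq_sq₀ (norm_nonneg _) (by positivity)).1 ((hasSum_norm_sq _).unique ?_)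
  have h := (hasSum_norm_sq a).mul (hasSum_norm_sq b)
    ((hasSum_norm_sq a).summable.mul_of_nonneg (hasSum_norm_sq b).summable
      (fun _ => by positivity) fun _ => by positivity)
  let e : (∀ v, κ v × μ v) ≃ (∀ v, κ v) × (∀ v, μ v) :=
    { toFun := fun x => (fun v => (x v).1, fun v => (x v).2)
      invFun := fun y v => (y.1 v, y.2 v)
      left_inv := fun _ => rfl
      right_inv := fun _ => rfl }
  rw [mul_pow]
  have h' := e.hasSum_iff.2 h
  have hfun : (fun j => ‖tensorState a b j‖ ^ 2) =
      (fun x : (∀ v, κ v) × (∀ v, μ v) => ‖a x.1‖ ^ 2 * ‖b x.2‖ ^ 2) ∘ e := by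
    funext j
    simp [e, tensorState_apply, mul_pow]
  rw [hfun]
  exact h'

/-! ### Pauli operators and graph states in coordinates -/

lemma pauliX_apply (a : Hilb (Fin 2)) (x : Fin 2) : pauliX.toIsometry a x = a (x + 1) := by
  have : pauliX.toIsometry a x = (!![0, 1; 1, 0] *ᵥ (a : Fin 2 → ℂ)) x := rfl
  rw [this]
  fin_cases x <;> simp [Matrix.mulVec, dotProduct]

lemma pauliZ_apply (a : Hilb (Fin 2)) (x : Fin 2) :
    pauliZ.toIsometry a x = (-1) ^ (x : ℕ) * a x := by
  have : pauliZ.toIsometry a x = (!![1, 0; 0, -1] *ᵥ (a : Fin 2 → ℂ)) x := rfl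
  rw [this]
  fin_cases x <;> simp [Matrix.mulVec, dotProduct]

lemma bits_add_single {V : Type*} [DecidableEq V] {x : V → Fin 2} {v : V} (h : x v = 0) :
    bits (x + Pi.single v 1) = bits x + Pi.single v 1 := by
  funext u
  by_cases hu : u = v
  · subst hu; simp [bits, h]
  · simp [bits, hu]

lemma add_single_add_single {V : Type*} [DecidableEq V] (x : V → Fin 2) (v : V) :
    x + Pi.single v 1 + Pi.single v 1 = x := by
  funext u
  by_cases hu : u = v
  · subst hu
    have : ∀ b : Fin 2, b + 1 + 1 = b := by decide
    simp [this]
  · simp [hu]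

section Qubits

variable {V : Type*} [Fintype V]

lemma opPow_pauliX_apply (q : V → Fin 2) (f : Hilb (V → Fin 2)) (x : V → Fin 2) :
    opPow (fun _ => pauliX) (bits q) f x = f (x + q) := by
  have h := tensorIsometry_reindex (fun v => (1 : Hilb (Fin 2) →ₗᵢ[ℂ] Hilb (Fin 2)))
    (fun v => pauliX.toIsometry ^ bits q v) (fun _ _ => 1) (fun v j => j + q v) ?_ f x
  · rw [tensorIsometry_one, Finset.prod_const_one, one_mul] at h
    exact h
  · intro v a j
    rw [bits]
    generalize q v = b
    fin_cases b <;> simp [pauliX_apply]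

lemma opPow_pauliZ_apply (p : V → ℕ) (f : Hilb (V → Fin 2)) (x : V → Fin 2) :
    opPow (fun _ => pauliZ) p f x = (-1) ^ (p ⬝ᵥ bits x) * f x := by
  have h := tensorIsometry_reindex (fun v => (1 : Hilb (Fin 2) →ₗᵢ[ℂ] Hilb (Fin 2)))
    (fun v => pauliZ.toIsometry ^ p v) (fun v j => (-1) ^ (p v * (j : ℕ))) (fun v j => j) ?_ f x
  · simpa [tensorIsometry_one, opPow, dotProduct, Finset.prod_pow_eq_pow_sum, bits] using h
  · intro v a j
    rw [LinearIsometry.coe_one, id_eq]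
    generalize p v = m
    induction m with
    | zero => simp
    | succ m ih =>
      rw [pow_succ', LinearIsometry.coe_mul, Function.comp_apply, pauliZ_apply, ih]
      ring

variable (G : SimpleGraph V) [DecidableRel G.Adj]

/-- The sign `(-1)^{(x · A x) / 2}`. -/
noncomputable def graphSign (x : V → Fin 2) : ℂ := (-1) ^ ((bits x ⬝ᵥ (G.adjMatrix ℕ *ᵥ bits x)) / 2)

lemma graphState_apply (x : V → Fin 2) :
    graphState G x = ((Real.sqrt (2 ^ Fintype.card V))⁻¹ : ℂ) * graphSign G x := rfl

lemma norm_graphSign (x : V → Fin 2) : ‖graphSign G x‖ = 1 := by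
  simp [graphSign]

lemma graphSign_mul_self (x : V → Fin 2) : graphSign G x * graphSign G x = 1 := by
  rw [graphSign, ← mul_pow]
  simp

lemma norm_graphState : ‖graphState G‖ = 1 := by
  classical
  refine (sq_eq_sq₀ (norm_nonneg _) zero_le_one).1 ((hasSum_norm_sq _).unique ?_)
  have h := hasSum_fintype fun x : V → Fin 2 => ‖graphState G x‖ ^ 2
  convert h using 1
  simp only [graphState_apply, norm_mul, norm_graphSign, mul_one, Finset.sum_const,
    Finset.card_univ, norm_inv, Complex.norm_real, Real.norm_eq_abs, inv_pow, sq_abs, nsmul_eq_mul]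
  rw [Real.sq_sqrt (by positivity)]
  simp

variable [DecidableEq V]

lemma adjMatrix_mulVec_bits_add_single (x : V → Fin 2) (v : V) :
    (G.adjMatrix ℕ *ᵥ bits (x + Pi.single v 1)) v = (G.adjMatrix ℕ *ᵥ bits x) v := by
  simp only [Matrix.mulVec, dotProduct]
  refine Finset.sum_congr rfl fun u _ => ?_
  by_cases hu : u = v
  · subst hu; simp
  · simp [bits, hu]

/-- This is the stabilizer relation of the graph state. As `A` is symmetric with zero diagonal,
raising `x_v` from 0 to 1 adds `2 (A x)_v` to the quadratic form. Lowering it is the same statement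
read backwards, because `(A x)_v` does not involve `x_v`. -/
lemma graphSign_add_single (x : V → Fin 2) (v : V) :
    graphSign G (x + Pi.single v 1) = graphSign G x * (-1) ^ (G.adjMatrix ℕ *ᵥ bits x) v := by
  have key : ∀ x : V → Fin 2, x v = 0 → graphSign G (x + Pi.single v 1) =
      graphSign G x * (-1) ^ (G.adjMatrix ℕ *ᵥ bits x) v := fun x hx => by
    have h : bits x ⬝ᵥ (G.adjMatrix ℕ *ᵥ Pi.single v 1) = (G.adjMatrix ℕ *ᵥ bits x) v := by
      rw [Matrix.dotProduct_mulVec, ← Matrix.mulVec_transpose, SimpleGraph.transpose_adjMatrix,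
        dotProduct_single_one]
    rw [graphSign, graphSign, bits_add_single hx, Matrix.mulVec_add, add_dotProduct,
      dotProduct_add, dotProduct_add, h, single_one_dotProduct, single_one_dotProduct,
      ← pow_add]
    congr 1
    have : (G.adjMatrix ℕ *ᵥ Pi.single v 1) v = 0 := by simp
    rw [this]
    omega
  have h2 : x v = 0 ∨ x v = 1 := by
    generalize x v = b
    revert b
    decide
  rcases h2 with h | h
  · exact key x h
  · have h' := key (x + Pi.single v 1) (by simp [h])
    rw [add_single_add_single, adjMatrix_mulVec_bits_add_single] at h'
    rw [h', mul_assoc, ← mul_pow]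
    simp

end Qubits

/-! ### The isometry extracting a qubit from a pair of observables -/

section Local

variable {ι : Type*} (X Z : PMObservable ι)

/-- The isometry `a ↦ (a + Z a) / 2 ⊗ |0⟩ + X (a - Z a) / 2 ⊗ |1⟩`. -/
noncomputable def extraction : Hilb ι →ₗᵢ[ℂ] Hilb (ι × Fin 2) :=
  branchIsometry
    ![(2⁻¹ : ℂ) • (LinearMap.id + Z.toIsometry.toLinearMap),
      (2⁻¹ : ℂ) • X.toIsometry.toLinearMap ∘ₗ (LinearMap.id - Z.toIsometry.toLinearMap)] <| by
    intro a
    -- The two branches have norms `‖a + Z a‖ / 2` and `‖a - Z a‖ / 2`, so no relation between `X`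
    -- and `Z` is needed.
    have h := parallelogram_law_with_norm ℂ a (Z.toIsometry a)
    simp only [LinearIsometry.norm_map] at h
    change ‖(2⁻¹ : ℂ) • (a + Z.toIsometry a)‖ ^ 2 +
      ‖(2⁻¹ : ℂ) • X.toIsometry (a - Z.toIsometry a)‖ ^ 2 = _
    rw [norm_smul, norm_smul, LinearIsometry.norm_map, norm_inv, Complex.norm_two]
    linarith

lemma extraction_apply_zero (a : Hilb ι) (i : ι) :
    extraction X Z a (i, 0) = 2⁻¹ * (a i + Z.toIsometry a i) := rfl

lemma extraction_apply_one (a : Hilb ι) (i : ι) :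
    extraction X Z a (i, 1) =
      2⁻¹ * (X.toIsometry a i - X.toIsometry (Z.toIsometry a) i) := by
  have h : extraction X Z a (i, 1) = 2⁻¹ * X.toIsometry (a - Z.toIsometry a) i := rfl
  rw [h, map_sub]
  rfl

/-- The isometry `a ↦ (a ⊗ |0⟩ - X a ⊗ |1⟩) / √2`. -/
noncomputable def minusIsometry : Hilb ι →ₗᵢ[ℂ] Hilb (ι × Fin 2) :=
  branchIsometry
    ![((√2)⁻¹ : ℂ) • LinearMap.id, -((√2)⁻¹ : ℂ) • X.toIsometry.toLinearMap] <| by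
    intro a
    simp [norm_smul, mul_pow]
    ring

lemma minusIsometry_apply_zero (a : Hilb ι) (i : ι) :
    minusIsometry X a (i, 0) = ((√2)⁻¹ : ℂ) * a i := rfl

lemma minusIsometry_apply_one (a : Hilb ι) (i : ι) :
    minusIsometry X a (i, 1) = -((√2)⁻¹ : ℂ) * X.toIsometry a i := rfl

/-- The Pauli operator `X ^ b` on the qubit. -/
noncomputable def localShift (ι : Type*) (b : Fin 2) : Hilb (ι × Fin 2) →ₗᵢ[ℂ] Hilb (ι × Fin 2) :=
  monomialIsometry (fun _ => 1) (fun _ => by simp)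
    ((Equiv.refl ι).prodCongr (Equiv.addRight b))

lemma localShift_apply (b : Fin 2) (f : Hilb (ι × Fin 2)) (j : ι × Fin 2) :
    localShift ι b f j = f (j.1, j.2 + b) :=
  one_mul _

lemma toIsometry_toIsometry (a : Hilb ι) : X.toIsometry (X.toIsometry a) = a := X.involutive a

/-- The branches are the spectral components of `Z`, the second one moved by `X`, so `Z` acts on
them by the sign `±1` with no error. -/
lemma extraction_map_Z_pow (m : ℕ) (a : Hilb ι) (j : ι × Fin 2) :
    extraction X Z ((Z.toIsometry ^ m) a) j = (-1) ^ (m * (j.2 : ℕ)) * extraction X Z a j := by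
  induction m with
  | zero => simp
  | succ m ih =>
    have key : ∀ b : Hilb ι, extraction X Z (Z.toIsometry b) j =
        (-1) ^ (j.2 : ℕ) * extraction X Z b j := fun b => by
      obtain ⟨i, x⟩ := j
      fin_cases x
      · simp only [Fin.zero_eta, extraction_apply_zero, toIsometry_toIsometry]
        simp [add_comm]
      · simp only [Fin.mk_one, extraction_apply_one, toIsometry_toIsometry]
        simp
        ring
    rw [pow_succ', LinearIsometry.coe_mul, Function.comp_apply, key, ih]
    ring

/-- With `c = X Z a + Z X a`, the defect has component `-c / 2` on `|0⟩` and `X c / 2` on `|1⟩`.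
These are the two branches of one isometry applied to `c`, which turns the estimate on norms into an
equality. -/
lemma localShift_extraction_sub (a : Hilb ι) :
    localShift ι 1 (extraction X Z a) - extraction X Z (X.toIsometry a) =
      (-(√2)⁻¹ : ℂ) • (minusIsometry X (X.toIsometry (Z.toIsometry a)) +
        minusIsometry X (Z.toIsometry (X.toIsometry a))) := by
  have h2 : ((√2 : ℝ) : ℂ)⁻¹ * ((√2 : ℝ) : ℂ)⁻¹ = 2⁻¹ := by
    rw [← mul_inv, ← Complex.ofReal_mul, Real.mul_self_sqrt (by norm_num)]
    norm_num
  ext ⟨i, x⟩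
  simp only [Complex.ofReal_inv, lp.coeFn_sub, lp.coeFn_smul, lp.coeFn_add, Pi.sub_apply, Pi.smul_apply,
      Pi.add_apply, smul_eq_mul, localShift_apply]
  have h3 : (1 : Fin 2) + 1 = 0 := rfl
  fin_cases x
  · simp only [Fin.zero_eta, zero_add, extraction_apply_zero, extraction_apply_one,
      minusIsometry_apply_zero]
    linear_combination (X.toIsometry (Z.toIsometry a) i + Z.toIsometry (X.toIsometry a) i) * h2
  · simp only [Fin.mk_one, h3, extraction_apply_zero, extraction_apply_one,
      minusIsometry_apply_one, toIsometry_toIsometry]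
    linear_combination -(Z.toIsometry a i + X.toIsometry (Z.toIsometry (X.toIsometry a)) i) * h2

end Local

/-! ### Pauli operators on the extracted qubits -/

section Global

variable {V : Type*} {ι : V → Type*}

/-- The Pauli operator `X^q` on the qubits. -/
noncomputable def qubitX (ι : V → Type*) (q : V → Fin 2) :
    Hilb (∀ v, ι v × Fin 2) →ₗᵢ[ℂ] Hilb (∀ v, ι v × Fin 2) :=
  monomialIsometry (fun _ => 1) (fun _ => by simp)
    (Equiv.piCongrRight fun v => (Equiv.refl (ι v)).prodCongr (Equiv.addRight (q v)))

lemma qubitX_apply (q : V → Fin 2) (f : Hilb (∀ v, ι v × Fin 2)) (j : ∀ v, ι v × Fin 2) :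
    qubitX ι q f j = f fun v => ((j v).1, (j v).2 + q v) :=
  one_mul _

lemma qubitX_zero (f : Hilb (∀ v, ι v × Fin 2)) : qubitX ι 0 f = f := by
  ext j
  simp [qubitX_apply]

lemma qubitX_add (q r : V → Fin 2) (f : Hilb (∀ v, ι v × Fin 2)) :
    qubitX ι (q + r) f = qubitX ι r (qubitX ι q f) := by
  ext j
  simp [qubitX_apply, add_comm (q _), add_assoc]

variable [Fintype V]

/-- The Pauli operator `Z^p` on the qubits. -/
noncomputable def qubitZ (ι : V → Type*) (p : V → ℕ) :
    Hilb (∀ v, ι v × Fin 2) →ₗᵢ[ℂ] Hilb (∀ v, ι v × Fin 2) :=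
  monomialIsometry (fun j => (-1) ^ (p ⬝ᵥ bits fun v => (j v).2)) (fun _ => by simp)
    (Equiv.refl _)

lemma qubitZ_apply (p : V → ℕ) (f : Hilb (∀ v, ι v × Fin 2)) (j : ∀ v, ι v × Fin 2) :
    qubitZ ι p f j = (-1) ^ (p ⬝ᵥ bits fun v => (j v).2) * f j := rfl

lemma qubitX_tensorState (q : V → Fin 2) (a : Hilb (∀ v, ι v)) (b : Hilb (V → Fin 2)) :
    qubitX ι q (tensorState a b) = tensorState a (opPow (fun _ => pauliX) (bits q) b) := by
  ext j
  rw [qubitX_apply, tensorState_apply, tensorState_apply, opPow_pauliX_apply]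
  rfl

lemma qubitZ_tensorState (p : V → ℕ) (a : Hilb (∀ v, ι v)) (b : Hilb (V → Fin 2)) :
    qubitZ ι p (tensorState a b) = tensorState a (opPow (fun _ => pauliZ) p b) := by
  ext j
  rw [qubitZ_apply, tensorState_apply, tensorState_apply, opPow_pauliZ_apply]
  ring

variable (X Z : ∀ v, PMObservable (ι v))

/-- The local isometry extracting one qubit from each subsystem. -/
noncomputable def extractAll : Hilb (∀ v, ι v) →ₗᵢ[ℂ] Hilb (∀ v, ι v × Fin 2) :=
  tensorIsometry fun v => extraction (X v) (Z v)

lemma extractAll_opPow_Z (p : V → ℕ) (φ : Hilb (∀ v, ι v)) :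
    extractAll X Z (opPow Z p φ) = qubitZ ι p (extractAll X Z φ) := by
  ext j
  rw [extractAll, opPow, tensorIsometry_comp, qubitZ_apply,
    tensorIsometry_reindex (fun v => extraction (X v) (Z v)) _
      (fun v j => (-1) ^ (p v * (j.2 : ℕ))) (fun v j => j)
      (fun v a j => extraction_map_Z_pow (X v) (Z v) (p v) a j),
    Finset.prod_pow_eq_pow_sum]
  rfl

variable [DecidableEq V]

/-- The failure of the extracted `X_v` to intertwine with the given one is controlled by the
anticommutator at `v`. -/
lemma norm_qubitX_extractAll_sub (v : V) (φ : Hilb (∀ v, ι v)) :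
    ‖qubitX ι (Pi.single v 1) (extractAll X Z φ) -
        extractAll X Z (opPow X (Pi.single v 1) φ)‖ =
      (√2)⁻¹ * ‖opPow X (Pi.single v 1) (opPow Z (Pi.single v 1) φ) +
        opPow Z (Pi.single v 1) (opPow X (Pi.single v 1) φ)‖ := by
  let e : V → ℕ := Pi.single v 1
  -- The single-vertex identity is used at `v`; at the other vertices both sides are plain
  -- extractions.
  let C : ∀ u, Hilb (ι u) →ₗᵢ[ℂ] Hilb (ι u × Fin 2) := fun u =>
    if u = v then minusIsometry (X u) else extraction (X u) (Z u)
  have h1 : qubitX ι (Pi.single v 1) (extractAll X Z φ) = tensorIsometry (fun u =>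
      (localShift (ι u) (Pi.single (M := fun _ => Fin 2) v 1 u)).comp
        (extraction (X u) (Z u))) φ := by
    ext j
    rw [tensorIsometry_reindex (fun v => extraction (X v) (Z v)) _ (fun _ _ => 1)
      (fun u j => (j.1, j.2 + Pi.single (M := fun _ => Fin 2) v 1 u))
      (fun u a j => by rw [one_mul]; exact localShift_apply _ _ _), qubitX_apply,
      Finset.prod_const_one, one_mul]
    rfl
  have h2 : extractAll X Z (opPow X (Pi.single v 1) φ) = tensorIsometry (fun u =>
      (extraction (X u) (Z u)).comp ((X u).toIsometry ^ e u)) φ :=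
    tensorIsometry_comp _ _ _
  have h3 : tensorIsometry C (opPow X e (opPow Z e φ)) = tensorIsometry (fun u =>
      (C u).comp (((X u).toIsometry ^ e u).comp ((Z u).toIsometry ^ e u))) φ := by
    rw [opPow, opPow, tensorIsometry_comp, tensorIsometry_comp]
    rfl
  have h4 : tensorIsometry C (opPow Z e (opPow X e φ)) = tensorIsometry (fun u =>
      (C u).comp (((Z u).toIsometry ^ e u).comp ((X u).toIsometry ^ e u))) φ := by
    rw [opPow, opPow, tensorIsometry_comp, tensorIsometry_comp]
    rfl
  have hshift : ∀ u, localShift (ι u) 0 = LinearIsometry.id := fun u => by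
    ext f j
    simp [localShift_apply]
  rw [h1, h2, tensorIsometry_sub_eq_smul_add v _ _
    (fun u => (C u).comp (((X u).toIsometry ^ e u).comp ((Z u).toIsometry ^ e u)))
    (fun u => (C u).comp (((Z u).toIsometry ^ e u).comp ((X u).toIsometry ^ e u))) (-(√2)⁻¹ : ℂ) _ _ _ _ φ, ← h3, ← h4,
    ← map_add, norm_smul, LinearIsometry.norm_map]
  · congr 1
    simp
  · intro u hu
    simp only [Pi.single_eq_of_ne hu, C, if_neg hu, e, hshift]
    rfl
  · intro u hu
    simp only [Pi.single_eq_of_ne hu, C, if_neg hu, e]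
    rfl
  · intro u hu
    simp only [Pi.single_eq_of_ne hu, e]
    rfl
  · intro a
    simp only [C, e, Pi.single_eq_same, pow_one, if_true]
    exact localShift_extraction_sub (X v) (Z v) a

/-- Only zero entries are raised, so addition modulo 2 agrees with addition of the integer exponents
in `opPow`. -/
lemma bits_induction {P : (V → Fin 2) → Prop} (h0 : P 0)
    (h : ∀ q v, q v = 0 → P q → P (q + Pi.single v 1)) (q : V → Fin 2) : P q := by
  have key : ∀ s : Finset V, P fun v => if v ∈ s then 1 else 0 := fun s => by
    induction s using Finset.induction_on with
    | empty => exact h0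
    | insert v s hv ih =>
      convert h _ v (by simp [hv]) ih using 1
      funext u
      by_cases hu : u = v
      · subst hu; simp [hv]
      · simp [hu]
  convert key (Finset.univ.filter fun v => q v = 1) using 1
  funext v
  simp only [Finset.mem_filter, Finset.mem_univ, true_and]
  generalize q v = b
  revert b
  decide

lemma sum_bits_add_single {q : V → Fin 2} {v : V} (h : q v = 0) :
    ∑ u, bits (q + Pi.single v 1) u = ∑ u, bits q u + 1 := by
  rw [bits_add_single h]
  simp [Finset.sum_add_distrib]

/-- Commuting isometries do not change the size of an anticommutator. -/
lemma norm_anticommutator_of_commute {E : Type*} [NormedAddCommGroup E] [NormedSpace ℂ E]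
    {x z U : E →ₗᵢ[ℂ] E} (hx : Commute U x) (hz : Commute U z) (φ : E) :
    ‖x (z (U φ)) + z (x (U φ))‖ = ‖x (z φ) + z (x φ)‖ := by
  have hx' : ∀ a, x (U a) = U (x a) := fun a => (DFunLike.congr_fun hx.eq a).symm
  have hz' : ∀ a, z (U a) = U (z a) := fun a => (DFunLike.congr_fun hz.eq a).symm
  rw [hz', hx', hx', hz', ← map_add, LinearIsometry.norm_map]

/-- Since `Z_v² = 1`, the anticommutator of `X_v` and `Z_v` commutes with `Z_v`; it also commutes
with `Z` at every other vertex. A bound on `ψ` therefore holds on every `Z^p ψ`. -/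
lemma norm_anticommutator_opPow_Z (v : V) (p : V → ℕ) (φ : Hilb (∀ v, ι v)) :
    ‖opPow X (Pi.single v 1) (opPow Z (Pi.single v 1) (opPow Z p φ)) +
        opPow Z (Pi.single v 1) (opPow X (Pi.single v 1) (opPow Z p φ))‖ =
      ‖opPow X (Pi.single v 1) (opPow Z (Pi.single v 1) φ) +
        opPow Z (Pi.single v 1) (opPow X (Pi.single v 1) φ)‖ := by
  have hz : ∀ a, opPow Z (Pi.single v 1) (opPow Z (Pi.single v 1) a) = a :=
    DFunLike.congr_fun (opPow_single_mul_self Z v)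
  have hsingle : ∀ m : ℕ, ∀ φ,
      ‖opPow X (Pi.single v 1) (opPow Z (Pi.single v 1) (opPow Z (Pi.single v m) φ)) +
        opPow Z (Pi.single v 1) (opPow X (Pi.single v 1) (opPow Z (Pi.single v m) φ))‖ =
      ‖opPow X (Pi.single v 1) (opPow Z (Pi.single v 1) φ) +
        opPow Z (Pi.single v 1) (opPow X (Pi.single v 1) φ)‖ := by
    intro m
    induction m with
    | zero => simp [opPow_zero]
    | succ m ih =>
      intro φ
      rw [Pi.single_add, opPow_add, LinearIsometry.coe_mul, Function.comp_apply, ih, hz]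
      rw [← LinearIsometry.norm_map (opPow Z (Pi.single v 1)), map_add, hz, add_comm]
  have hp : p = Function.update p v 0 + Pi.single v (p v) := by
    funext u
    by_cases hu : u = v
    · subst hu; simp
    · simp [hu]
  rw [hp, opPow_add, LinearIsometry.coe_mul, Function.comp_apply,
    norm_anticommutator_of_commute _ (opPow_commute Z _ _), hsingle]
  refine opPow_commute_of_disjoint Z X _ _ fun u => ?_
  by_cases hu : u = v
  · subst hu; simp
  · simp [hu]

/-- The flips are moved through one vertex at a time. When `v` is added, the flips already present
avoid `v`, so they do not alter the size of the anticommutator there. -/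
lemma norm_extractAll_opPow_sub {c : ℝ} {φ : Hilb (∀ v, ι v)}
    (hφ : ∀ v, ‖opPow X (Pi.single v 1) (opPow Z (Pi.single v 1) φ) +
        opPow Z (Pi.single v 1) (opPow X (Pi.single v 1) φ)‖ ≤ c) (q : V → Fin 2) :
    ‖extractAll X Z (opPow X (bits q) φ) - qubitX ι q (extractAll X Z φ)‖ ≤
      (∑ v, bits q v : ℕ) * ((√2)⁻¹ * c) := by
  induction q using bits_induction with
  | h0 =>
    have : bits (0 : V → Fin 2) = 0 := rfl
    simp [this, opPow_zero, qubitX_zero]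
  | h q v hv ih =>
    have h1 := norm_qubitX_extractAll_sub X Z v (opPow X (bits q) φ)
    rw [norm_anticommutator_of_commute (opPow_commute X _ _), norm_sub_rev] at h1
    · rw [sum_bits_add_single hv, bits_add_single hv, add_comm (bits q), opPow_add,
        LinearIsometry.coe_mul, Function.comp_apply, qubitX_add]
      have h2 := norm_sub_le_norm_sub_add_norm_sub
        (extractAll X Z (opPow X (Pi.single v 1) (opPow X (bits q) φ)))
        (qubitX ι (Pi.single v 1) (extractAll X Z (opPow X (bits q) φ)))
        (qubitX ι (Pi.single v 1) (qubitX ι q (extractAll X Z φ)))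
      rw [← map_sub (qubitX ι (Pi.single v 1)), LinearIsometry.norm_map] at h2
      have h3 := mul_le_mul_of_nonneg_left (hφ v) (by positivity : 0 ≤ (√2)⁻¹)
      push_cast
      push_cast at ih
      linarith
    · refine opPow_commute_of_disjoint X Z _ _ fun u => ?_
      by_cases hu : u = v
      · subst hu; simp [bits, hv]
      · simp [hu]

end Global

/-! ### Anticommutation from a triangle -/

section Triangle

variable {V : Type*} [Fintype V] [DecidableEq V] (G : SimpleGraph V) [DecidableRel G.Adj]
  {ι : V → Type*} (X Z : ∀ v, PMObservable (ι v))

lemma adjMatrix_mulVec_single_apply (v t : V) :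
    (G.adjMatrix ℕ *ᵥ Pi.single v 1) t = if G.Adj t v then 1 else 0 := by
  rw [Matrix.mulVec_single_one, Matrix.col_apply, SimpleGraph.adjMatrix_apply]

lemma stabilizer_eq_tensorIsometry (v : V) :
    stabilizer G X Z v = tensorIsometry fun t =>
      (X t).toIsometry ^ (if t = v then 1 else 0) *
        (Z t).toIsometry ^ (if G.Adj t v then 1 else 0) := by
  rw [stabilizer, opPow, opPow, tensorIsometry_mul]
  congr 1
  funext t
  rw [adjMatrix_mulVec_single_apply, Pi.single_apply]

lemma triangleOp_eq_tensorIsometry {u v w : V} (huv : u ≠ v) (huw : u ≠ w) (hvw : v ≠ w) :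
    triangleOp G X Z {v, u, w} = tensorIsometry fun t =>
      (X t).toIsometry ^ (if t = v ∨ t = u ∨ t = w then 1 else 0) *
        (Z t).toIsometry ^ ((if G.Adj t u then 1 else 0) + (if G.Adj t v then 1 else 0) +
          (if G.Adj t w then 1 else 0)) := by
  have h : (fun t => if t ∈ ({v, u, w} : Finset V) then 1 else 0 : V → ℕ) =
      Pi.single u 1 + Pi.single v 1 + Pi.single w 1 := by
    funext t
    simp only [Finset.mem_insert, Finset.mem_singleton, Pi.add_apply, Pi.single_apply]
    by_cases h1 : t = v
    · subst h1; simp [huv.symm, hvw]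
    · by_cases h2 : t = u
      · subst h2; simp [huv, huw]
      · simp [h1, h2]
  rw [triangleOp, opPow, opPow, tensorIsometry_mul]
  congr 1
  funext t
  rw [h, Matrix.mulVec_add, Matrix.mulVec_add, Pi.add_apply, Pi.add_apply,
    adjMatrix_mulVec_single_apply, adjMatrix_mulVec_single_apply, adjMatrix_mulVec_single_apply]
  simp

/-- The order `u, v, w` matters: at `v` the factors multiply to `Z X Z`, while at `u` and `w` the
two `Z` factors are adjacent and cancel. -/
lemma stabilizer_mul_eq_triangleOp {u v w : V} (huv : G.Adj u v) (huw : G.Adj u w)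
    (hvw : G.Adj v w) :
    stabilizer G X Z u * stabilizer G X Z v * stabilizer G X Z w =
      opPow Z (Pi.single v 1) * triangleOp G X Z {v, u, w} * opPow Z (Pi.single v 1) := by
  rw [triangleOp_eq_tensorIsometry G X Z huv.ne huw.ne hvw.ne]
  simp only [stabilizer_eq_tensorIsometry, opPow, tensorIsometry_mul]
  congr 1
  funext t
  have hz := (Z t).toIsometry_mul_self
  by_cases h1 : t = v
  · subst h1
    simp [huv.symm, hvw, huv.ne', hvw.ne, pow_two, hz, mul_assoc]
  by_cases h2 : t = u
  · subst h2
    simp [huv, huw, huv.ne, huw.ne, pow_two, hz, mul_assoc]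
  by_cases h3 : t = w
  · subst h3
    simp [huw.symm, hvw.symm, huw.ne', hvw.ne', pow_two, hz]
  · simp [h1, h2, h3, pow_add, mul_assoc]

/-- At `v` the exponent of `Z` is 2, one from each of `u` and `w`, so only `X_v` remains there and
`U` acts trivially at `v`. -/
lemma exists_triangleOp_eq_mul {u v w : V} (huv : G.Adj u v) (huw : G.Adj u w)
    (hvw : G.Adj v w) :
    ∃ U, triangleOp G X Z {v, u, w} = opPow X (Pi.single v 1) * U ∧
      Commute U (opPow X (Pi.single v 1)) ∧ Commute U (opPow Z (Pi.single v 1)) := by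
  let f : ∀ t, Hilb (ι t) →ₗᵢ[ℂ] Hilb (ι t) := fun t => if t = v then 1 else
      (X t).toIsometry ^ (if t = v ∨ t = u ∨ t = w then 1 else 0) *
        (Z t).toIsometry ^ ((if G.Adj t u then 1 else 0) + (if G.Adj t v then 1 else 0) +
          (if G.Adj t w then 1 else 0))
  have hc : ∀ M : ∀ v, PMObservable (ι v),
      Commute (tensorIsometry f) (opPow M (Pi.single v 1)) := fun M => by
    rw [Commute, SemiconjBy, opPow, tensorIsometry_mul, tensorIsometry_mul]
    congr 1
    funext t
    by_cases h : t = v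
    · simp [f, h]
    · simp [h]
  refine ⟨tensorIsometry f, ?_, hc X, hc Z⟩
  rw [triangleOp_eq_tensorIsometry G X Z huv.ne huw.ne hvw.ne, opPow, tensorIsometry_mul]
  congr 1
  funext t
  by_cases h : t = v
  · subst h
    simp [f, huv.symm, hvw, pow_two, (Z t).toIsometry_mul_self]
  · simp [f, h]

/-- The observables at a vertex of a triangle almost anticommute. -/
lemma norm_anticommutator_le {u v w : V} (huv : G.Adj u v) (huw : G.Adj u w)
    (hvw : G.Adj v w) {ψ : Hilb (∀ v, ι v)} {d : ℝ}
    (hS : ∀ t, ‖stabilizer G X Z t ψ - ψ‖ ≤ d)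
    (hT : ‖triangleOp G X Z {v, u, w} ψ + ψ‖ ≤ d) :
    ‖opPow X (Pi.single v 1) (opPow Z (Pi.single v 1) ψ) +
      opPow Z (Pi.single v 1) (opPow X (Pi.single v 1) ψ)‖ ≤ 4 * d := by
  obtain ⟨U, hU, hx, hz⟩ := exists_triangleOp_eq_mul G X Z huv huw hvw
  have hprod := DFunLike.congr_fun (stabilizer_mul_eq_triangleOp G X Z huv huw hvw) ψ
  rw [hU] at hprod hT
  have hzz : ∀ a, opPow Z (Pi.single v 1) (opPow Z (Pi.single v 1) a) = a :=
    DFunLike.congr_fun (opPow_single_mul_self Z v)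
  have hUz := DFunLike.congr_fun hz.eq ψ
  simp only [LinearIsometry.coe_mul, Function.comp_apply] at hprod hT hUz
  rw [hUz] at hprod
  have h3 : ‖stabilizer G X Z u (stabilizer G X Z v (stabilizer G X Z w ψ)) - ψ‖ ≤ 3 * d := by
    have h1 := norm_sub_le_norm_sub_add_norm_sub (stabilizer G X Z v (stabilizer G X Z w ψ))
      (stabilizer G X Z v ψ) ψ
    have h2 := norm_sub_le_norm_sub_add_norm_sub
      (stabilizer G X Z u (stabilizer G X Z v (stabilizer G X Z w ψ))) (stabilizer G X Z u ψ) ψ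
    rw [← map_sub, LinearIsometry.norm_map] at h1 h2
    linarith [hS u, hS v, hS w]
  -- Inserting `U` and multiplying by `Z_v` turns the anticommutator into `Z X Z U ψ + X U ψ`, the
  -- stabilizer product plus the triangle operator on `ψ`.
  rw [← norm_anticommutator_of_commute hx hz ψ,
    ← LinearIsometry.norm_map (opPow Z (Pi.single v 1)), map_add, hzz]
  rw [hprod] at h3
  refine le_trans (le_of_eq ?_) ((norm_add_le _ _).trans ((add_le_add h3 hT).trans_eq (by ring)))
  congr 1
  abel

end Triangle

/-! ### Approximately stabilized vectors -/

section Stabilized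

variable {V : Type*} {κ μ : V → Type*}

/-- Normalising `a` moves it by `|‖a‖ - 1| ≤ d`, which doubles the error. If `a = 0` then `d ≥ 1`,
and any unit vector is within `2 ≤ 2d`. -/
lemma exists_unit_tensorState {w : Hilb (∀ v, κ v × μ v)} (hw : ‖w‖ = 1)
    {g : Hilb (∀ v, μ v)} (hg : ‖g‖ = 1) {a : Hilb (∀ v, κ v)} {d : ℝ}
    (h : ‖w - tensorState a g‖ ≤ d) :
    ∃ b : Hilb (∀ v, κ v), ‖b‖ = 1 ∧ ‖w - tensorState b g‖ ≤ 2 * d := by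
  by_cases ha : a = 0
  · have h0 : tensorState a g = 0 := by
      rw [← norm_eq_zero, norm_tensorState, ha, norm_zero, zero_mul]
    rw [h0, sub_zero, hw] at h
    have hne : Nonempty (∀ v, κ v × μ v) := by
      by_contra hn
      rw [not_nonempty_iff] at hn
      have : w = 0 := by ext j; exact hn.elim j
      simp [this] at hw
    obtain ⟨j⟩ := hne
    have hk : ‖(ket fun v => (j v).1 : Hilb (∀ v, κ v))‖ = 1 := by
      classical
      rw [← sq_eq_sq₀ (norm_nonneg _) zero_le_one, ← inner_self_eq_norm_sq (𝕜 := ℂ), inner_ket]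
      simp
    refine ⟨_, hk, ?_⟩
    have h2 := norm_sub_le w (tensorState (ket fun v => (j v).1) g)
    rw [norm_tensorState, hk, hg, hw] at h2
    linarith
  · have hpos : ‖a‖ ≠ 0 := norm_ne_zero_iff.2 ha
    refine ⟨((‖a‖⁻¹ : ℝ) : ℂ) • a, by simp [norm_smul, hpos], ?_⟩
    have h1 : ‖a - ((‖a‖⁻¹ : ℝ) : ℂ) • a‖ = |‖a‖ - 1| := by
      have : a - ((‖a‖⁻¹ : ℝ) : ℂ) • a = ((1 - ‖a‖⁻¹ : ℝ) : ℂ) • a := by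
        push_cast
        rw [sub_smul, one_smul]
      rw [this, norm_smul, Complex.norm_real, Real.norm_eq_abs, ← abs_norm a, ← abs_mul, abs_norm,
        sub_mul, inv_mul_cancel₀ hpos, one_mul]
    have h2 : |‖a‖ - 1| ≤ d := by
      have := abs_norm_sub_norm_le (tensorState a g) w
      rw [norm_tensorState, hg, hw, mul_one, norm_sub_rev] at this
      exact this.trans h
    have h3 := norm_sub_le_norm_sub_add_norm_sub w (tensorState a g)
      (tensorState (((‖a‖⁻¹ : ℝ) : ℂ) • a) g)
    rw [← tensorState_sub, norm_tensorState, hg, h1] at h3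
    linarith

variable [Fintype V] [DecidableEq V]

lemma norm_qubitX_sub_le {w : Hilb (∀ v, κ v × Fin 2)} {η : ℝ}
    (h : ∀ v, ‖qubitX κ (Pi.single v 1) w - w‖ ≤ η) (y : V → Fin 2) :
    ‖qubitX κ y w - w‖ ≤ (∑ v, bits y v : ℕ) * η := by
  induction y using bits_induction with
  | h0 =>
    have : bits (0 : V → Fin 2) = 0 := rfl
    simp [this, qubitX_zero]
  | h y v hv ih =>
    rw [sum_bits_add_single hv, qubitX_add]
    have h2 := norm_sub_le_norm_sub_add_norm_sub (qubitX κ (Pi.single v 1) (qubitX κ y w))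
      (qubitX κ (Pi.single v 1) w) w
    rw [← map_sub, LinearIsometry.norm_map] at h2
    have := h v
    push_cast
    push_cast at ih
    linarith

/-- Pairing each string with its complement shows that the mean weight is `n / 2`; this is the
factor in the averaging bound. -/
lemma two_mul_sum_sum_bits :
    2 * ∑ y : V → Fin 2, ∑ v, bits y v = 2 ^ Fintype.card V * Fintype.card V := by
  have h : ∑ y : V → Fin 2, ∑ v, bits y v = ∑ y : V → Fin 2, ∑ v, bits (y + 1) v :=
    (Equiv.sum_comp (Equiv.addRight (1 : V → Fin 2)) fun y => ∑ v, bits y v).symm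
  have hb : ∀ b : Fin 2, (b : ℕ) + ((b + 1 : Fin 2) : ℕ) = 1 := by decide
  calc 2 * ∑ y : V → Fin 2, ∑ v, bits y v
      = ∑ y : V → Fin 2, ∑ v, (bits y v + bits (y + 1) v) := by
        rw [two_mul]
        nth_rewrite 2 [h]
        simp [Finset.sum_add_distrib]
    _ = 2 ^ Fintype.card V * Fintype.card V := by
        simp [bits, hb]

/-- A vector that is almost invariant under each qubit flip is close to a vector that is invariant
under all of them. -/
lemma exists_invariant_near {w : Hilb (∀ v, κ v × Fin 2)} {η : ℝ}
    (h : ∀ v, ‖qubitX κ (Pi.single v 1) w - w‖ ≤ η) :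
    ∃ a : Hilb (∀ v, κ v × Fin 2), (∀ y, qubitX κ y a = a) ∧
      ‖w - a‖ ≤ Fintype.card V / 2 * η := by
  let N : ℝ := 2 ^ Fintype.card V
  have hN : 0 < N := by positivity
  -- The witness is the average over the group of flips; translation permutes its terms.
  refine ⟨((N⁻¹ : ℝ) : ℂ) • ∑ y, qubitX κ y w, fun z => ?_, ?_⟩
  · rw [map_smul, map_sum]
    simp only [← qubitX_add]
    congr 1
    exact Equiv.sum_comp (Equiv.addRight z) fun y => qubitX κ y w
  · have h1 : w - ((N⁻¹ : ℝ) : ℂ) • ∑ y, qubitX κ y w =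
        ((N⁻¹ : ℝ) : ℂ) • ∑ y, (w - qubitX κ y w) := by
      have hNc : (N : ℂ) ≠ 0 := by exact_mod_cast hN.ne'
      have hc : ((Fintype.card (V → Fin 2) : ℕ) : ℂ) = N := by simp [N]
      rw [Finset.sum_sub_distrib, smul_sub, Finset.sum_const, Finset.card_univ,
        ← Nat.cast_smul_eq_nsmul ℂ, hc, smul_smul]
      simp [hNc]
    have h2 : ‖∑ y, (w - qubitX κ y w)‖ ≤ N * (Fintype.card V / 2 * η) := by
      calc ‖∑ y, (w - qubitX κ y w)‖ ≤ ∑ y : V → Fin 2, (∑ v, bits y v : ℕ) * η :=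
            norm_sum_le_of_le _ fun y _ => by
              rw [norm_sub_rev]
              exact norm_qubitX_sub_le h y
        _ = N * (Fintype.card V / 2 * η) := by
            have h3 : (2 : ℝ) * ((∑ y : V → Fin 2, ∑ v, bits y v : ℕ) : ℝ) =
                N * Fintype.card V := by
              simp only [N]
              exact_mod_cast two_mul_sum_sum_bits (V := V)
            rw [← Finset.sum_mul, ← Nat.cast_sum]
            linear_combination η / 2 * h3
    rw [h1, norm_smul, Complex.norm_real, Real.norm_of_nonneg (by positivity), inv_mul_le_iff₀ hN]
    exact h2

variable (G : SimpleGraph V) [DecidableRel G.Adj]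

/-- A unit vector that is almost stabilized by each `X_v Z^{A 1_v}` is close to a product with the
graph state. -/
lemma exists_tensorState_graphState_near {w : Hilb (∀ v, κ v × Fin 2)} (hw : ‖w‖ = 1) {η : ℝ}
    (h : ∀ v, ‖qubitX κ (Pi.single v 1) (qubitZ κ (G.adjMatrix ℕ *ᵥ Pi.single v 1) w) - w‖ ≤ η) :
    ∃ junk : Hilb (∀ v, κ v), ‖junk‖ = 1 ∧
      ‖w - tensorState junk (graphState G)‖ ≤ Fintype.card V * η := by
  -- `D` is the product of controlled-`Z` gates along the edges. It is its own inverse and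
  -- conjugates each stabilizer to a plain bit flip.
  let D : Hilb (∀ v, κ v × Fin 2) →ₗᵢ[ℂ] Hilb (∀ v, κ v × Fin 2) :=
    monomialIsometry (fun j => graphSign G fun v => (j v).2) (fun _ => norm_graphSign G _)
      (Equiv.refl _)
  have hD : ∀ f j, D f j = graphSign G (fun v => (j v).2) * f j := fun _ _ => rfl
  have hDD : ∀ f, D (D f) = f := fun f => by
    ext j
    rw [hD, hD, ← mul_assoc, graphSign_mul_self, one_mul]
  have hconj : ∀ v, D (qubitX κ (Pi.single v 1)
      (qubitZ κ (G.adjMatrix ℕ *ᵥ Pi.single v 1) w)) = qubitX κ (Pi.single v 1) (D w) := by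
    intro v
    ext j
    have h1 : ∀ x : V → Fin 2, (G.adjMatrix ℕ *ᵥ Pi.single v 1) ⬝ᵥ bits x =
        (G.adjMatrix ℕ *ᵥ bits x) v := fun x => by
      rw [dotProduct_comm, Matrix.dotProduct_mulVec, ← Matrix.mulVec_transpose,
        SimpleGraph.transpose_adjMatrix, dotProduct_single_one]
    have h2 := graphSign_add_single G (fun v => (j v).2) v
    rw [← adjMatrix_mulVec_bits_add_single, ← h1] at h2
    rw [hD, qubitX_apply, qubitX_apply, qubitZ_apply, hD, ← mul_assoc]
    congr 1
    exact h2.symm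
  obtain ⟨a, ha, haw⟩ := exists_invariant_near (w := D w) (η := η) fun v => by
    rw [← hconj, ← map_sub, LinearIsometry.norm_map]
    exact h v
  -- A flip-invariant vector is determined by its values where all qubits are 0, so it is `b`
  -- tensored with the unnormalised uniform superposition.
  let emb : (∀ v, κ v) → ∀ v, κ v × Fin 2 := fun k v => (k v, 0)
  have hemb : Function.Injective emb := fun k l hkl =>
    funext fun v => congrArg Prod.fst (congrFun hkl v)
  let b : Hilb (∀ v, κ v) := ⟨fun k => a (emb k),
    memℓp_two_of_summable ((hasSum_norm_sq a).summable.comp_injective hemb)⟩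
  have hab : ∀ j, a j = b fun v => (j v).1 := fun j => by
    have h1 := congrArg (fun f : Hilb (∀ v, κ v × Fin 2) => f (emb fun v => (j v).1))
      (ha fun v => (j v).2)
    simp only [qubitX_apply, emb, zero_add] at h1
    exact h1
  have hs : ((Real.sqrt (2 ^ Fintype.card V) : ℝ) : ℂ) ≠ 0 := by
    exact_mod_cast (Real.sqrt_pos.2 (by positivity)).ne'
  have hDa : D a = tensorState (((Real.sqrt (2 ^ Fintype.card V) : ℝ) : ℂ) • b)
      (graphState G) := by
    ext j
    rw [hD, tensorState_apply, graphState_apply, hab, lp.coeFn_smul, Pi.smul_apply, smul_eq_mul]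
    field_simp
  have hfin : ‖w - tensorState (((Real.sqrt (2 ^ Fintype.card V) : ℝ) : ℂ) • b)
      (graphState G)‖ ≤ Fintype.card V / 2 * η := by
    rw [← hDa]
    nth_rewrite 1 [← hDD w]
    rw [← map_sub, LinearIsometry.norm_map]
    exact haw
  obtain ⟨junk, hj, hle⟩ := exists_unit_tensorState hw (norm_graphState G) hfin
  exact ⟨junk, hj, hle.trans_eq (by ring)⟩

end Stabilized

/-! ### From expectation values to norms -/

section Expectation

variable {E : Type*} [NormedAddCommGroup E] [InnerProductSpace ℂ E] {S : E →ₗᵢ[ℂ] E} {ψ : E}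
  {ε : ℝ}

lemma norm_map_sub_le_of_re_inner (hψ : ‖ψ‖ = 1) (h : 1 - ε ≤ (inner ℂ ψ (S ψ)).re) :
    ‖S ψ - ψ‖ ≤ √(2 * ε) := by
  refine Real.le_sqrt_of_sq_le ?_
  have h1 := norm_sub_sq (𝕜 := ℂ) ψ (S ψ)
  rw [LinearIsometry.norm_map, hψ, norm_sub_rev, RCLike.re_to_complex] at h1
  linarith

lemma norm_map_add_le_of_re_inner (hψ : ‖ψ‖ = 1) (h : 1 - ε ≤ -(inner ℂ ψ (S ψ)).re) :
    ‖S ψ + ψ‖ ≤ √(2 * ε) := by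
  refine Real.le_sqrt_of_sq_le ?_
  have h1 := norm_add_sq (𝕜 := ℂ) ψ (S ψ)
  rw [LinearIsometry.norm_map, hψ, add_comm ψ, RCLike.re_to_complex] at h1
  linarith

end Expectation

/-- From `e² ≤ 2e` it suffices that `2(1 + 4√2) ≤ (2√2 + 1)² = 9 + 4√2`, that is `4√2 ≤ 7`. Then
`(2√2 + 1)√n = 2√(2n) + √n` is absorbed by the last two summands. -/
lemma le_self_test_bound {e n a b c δ : ℝ} (hn : 0 ≤ n) (ha : 0 ≤ a) (hb : 0 ≤ b)
    (hδ : 0 ≤ δ) (hc : c = δ ^ 2) (he0 : 0 ≤ e) (he2 : e ≤ 2)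
    (he : e ≤ n * (1 + 4 * √2) * c) :
    e ≤ (2 * a + 2 * √(2 * n) + √(b + n)) * δ := by
  have hr : √2 ≤ 7 / 4 := by
    rw [Real.sqrt_le_left (by norm_num)]
    norm_num
  have hr2 : √2 ^ 2 = 2 := Real.sq_sqrt (by norm_num)
  have hn2 : √n ^ 2 = n := Real.sq_sqrt hn
  have h1 : e ≤ (2 * √2 + 1) * √n * δ := by
    refine le_of_sq_le_sq ?_ (by positivity)
    have h2 : e ^ 2 ≤ 2 * (n * (1 + 4 * √2) * c) := by nlinarith
    have h3 : ((2 * √2 + 1) * √n * δ) ^ 2 = (9 + 4 * √2) * (n * δ ^ 2) := by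
      rw [mul_pow, mul_pow, hn2]
      linear_combination 4 * n * δ ^ 2 * hr2
    have h4 : 0 ≤ n * δ ^ 2 := by positivity
    rw [h3]
    rw [hc] at h2
    nlinarith
  have h5 : √n ≤ √(b + n) := Real.sqrt_le_sqrt (by linarith)
  refine h1.trans (mul_le_mul_of_nonneg_right ?_ hδ)
  rw [Real.sqrt_mul (by norm_num) n]
  linarith

/-! ### Assembling the robust self-test -/

section SelfTest

variable {V : Type*} [Fintype V] [DecidableEq V] (G : SimpleGraph V) [DecidableRel G.Adj]
  {ι : V → Type*} (X Z : ∀ v, PMObservable (ι v))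

lemma norm_anticommutator_le_of_isNClique (hG : ∀ v : V, ∃ T : Finset V, G.IsNClique 3 T ∧ v ∈ T)
    {ψ : Hilb (∀ v, ι v)} {d : ℝ} (hS : ∀ v, ‖stabilizer G X Z v ψ - ψ‖ ≤ d)
    (hT : ∀ T : Finset V, G.IsNClique 3 T → ‖triangleOp G X Z T ψ + ψ‖ ≤ d) (v : V) :
    ‖opPow X (Pi.single v 1) (opPow Z (Pi.single v 1) ψ) +
      opPow Z (Pi.single v 1) (opPow X (Pi.single v 1) ψ)‖ ≤ 4 * d := by
  obtain ⟨T, hT3, hv⟩ := hG v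
  obtain ⟨u, w, huw, hTe⟩ := Finset.card_eq_two.1
    (by rw [Finset.card_erase_of_mem hv, hT3.card_eq] : (T.erase v).card = 2)
  have hTv : T = {v, u, w} := by rw [← hTe, Finset.insert_erase hv]
  subst hTv
  obtain ⟨hvu, hvw, huw⟩ := SimpleGraph.is3Clique_triple_iff.1 hT3
  exact norm_anticommutator_le G X Z hvu.symm huw hvw hS (hT _ hT3)

/-- The intertwining defect arises on `Z^{A 1_v} ψ`, where the anticommutator has the same norm as
on `ψ`; the rest is the stabilizer error. -/
lemma norm_qubitX_qubitZ_sub_le {ψ : Hilb (∀ v, ι v)} {d c : ℝ} {v : V}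
    (hS : ‖stabilizer G X Z v ψ - ψ‖ ≤ d)
    (hc : ‖opPow X (Pi.single v 1) (opPow Z (Pi.single v 1) ψ) +
      opPow Z (Pi.single v 1) (opPow X (Pi.single v 1) ψ)‖ ≤ c) :
    ‖qubitX ι (Pi.single v 1) (qubitZ ι (G.adjMatrix ℕ *ᵥ Pi.single v 1) (extractAll X Z ψ)) -
      extractAll X Z ψ‖ ≤ (√2)⁻¹ * c + d := by
  have h1 := norm_qubitX_extractAll_sub X Z v (opPow Z (G.adjMatrix ℕ *ᵥ Pi.single v 1) ψ)
  rw [norm_anticommutator_opPow_Z, extractAll_opPow_Z] at h1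
  have h2 : ‖extractAll X Z (stabilizer G X Z v ψ) - extractAll X Z ψ‖ ≤ d := by
    rw [← map_sub, LinearIsometry.norm_map]
    exact hS
  refine (norm_sub_le_norm_sub_add_norm_sub _ _ _).trans (add_le_add ?_ h2)
  exact h1.trans_le (mul_le_mul_of_nonneg_left hc (by positivity))

end SelfTest

end GraphStateTest
theorem theorem2 {V : Type v} [Fintype V] [DecidableEq V]
    (G : SimpleGraph V) [DecidableRel G.Adj]
    (hG : ∀ v : V, ∃ T : Finset V, G.IsNClique 3 T ∧ v ∈ T)
    (ε : ℝ) (hε : 0 < ε)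
    (ι : V → Type u) (X' Z' : ∀ v, PMObservable (ι v))
    (ψ' : Hilb (∀ v, ι v)) (hψ' : ‖ψ'‖ = 1)
    (hS : ∀ v : V, 1 - ε ≤ (inner ℂ ψ' (stabilizer G X' Z' v ψ')).re)
    (hT : ∀ T : Finset V, G.IsNClique 3 T →
      1 - ε ≤ -(inner ℂ ψ' (triangleOp G X' Z' T ψ')).re) :
    ∃ (κ : V → Type u) (Φ : ∀ v, Hilb (ι v) →ₗᵢ[ℂ] Hilb (κ v × Fin 2))
      (junk : Hilb (∀ v, κ v)), ‖junk‖ = 1 ∧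
      ∀ p q : V → Fin 2,
        ‖tensorIsometry Φ (opPow X' (bits q) (opPow Z' (bits p) ψ')) -
            tensorState junk
              (opPow (fun _ => pauliX) (bits q)
                (opPow (fun _ => pauliZ) (bits p) (graphState G)))‖ ≤
          (2 * √((bits p ⬝ᵥ bits p : ℕ) : ℝ) + 2 * √(2 * (Fintype.card V : ℝ)) +
              √((G.edgeFinset.card : ℝ) + (Fintype.card V : ℝ))) *
            (2 * ε) ^ (1 / 4 : ℝ) := by
  have hS' : ∀ v, ‖stabilizer G X' Z' v ψ' - ψ'‖ ≤ √(2 * ε) := fun v =>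
    norm_map_sub_le_of_re_inner hψ' (hS v)
  have hN := norm_anticommutator_le_of_isNClique G X' Z' hG hS' fun T h =>
    norm_map_add_le_of_re_inner hψ' (hT T h)
  obtain ⟨junk, hj, hjunk⟩ := exists_tensorState_graphState_near G
    (w := extractAll X' Z' ψ') (by rw [LinearIsometry.norm_map, hψ'])
    fun v => norm_qubitX_qubitZ_sub_le G X' Z' (hS' v) (hN v)
  -- The junk register is the original space; the qubit is an added ancilla.
  refine ⟨ι, fun v => extraction (X' v) (Z' v), junk, hj, fun p q => ?_⟩
  change ‖extractAll X' Z' _ - _‖ ≤ _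
  rw [← qubitX_tensorState, ← qubitZ_tensorState]
  have h1 := norm_extractAll_opPow_sub X' Z' (φ := opPow Z' (bits p) ψ')
    (fun v => (norm_anticommutator_opPow_Z X' Z' v (bits p) ψ').trans_le (hN v)) q
  rw [extractAll_opPow_Z] at h1
  have h2 : ‖qubitX ι q (qubitZ ι (bits p) (extractAll X' Z' ψ')) -
      qubitX ι q (qubitZ ι (bits p) (tensorState junk (graphState G)))‖ ≤
      Fintype.card V * ((√2)⁻¹ * (4 * √(2 * ε)) + √(2 * ε)) := by
    rw [← map_sub, ← map_sub, LinearIsometry.norm_map, LinearIsometry.norm_map]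
    exact hjunk
  have hq : ((∑ v, bits q v : ℕ) : ℝ) ≤ Fintype.card V := by
    have : ∑ v, bits q v ≤ ∑ _v : V, 1 := Finset.sum_le_sum fun v _ => by
      rw [bits]
      omega
    exact_mod_cast this.trans_eq (by simp)
  have hr : (√2)⁻¹ * 4 = 2 * √2 := by
    have h2 : √2 * √2 = 2 := Real.mul_self_sqrt (by norm_num)
    field_simp
    linarith
  have hd : √(2 * ε) = ((2 * ε) ^ (1 / 4 : ℝ)) ^ 2 := by
    rw [Real.sqrt_eq_rpow, ← Real.rpow_natCast, ← Real.rpow_mul (by positivity)]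
    norm_num
  refine le_self_test_bound (Nat.cast_nonneg _) (Real.sqrt_nonneg _) (Nat.cast_nonneg _)
    (by positivity) hd (norm_nonneg _) ?_ ?_
  · refine (norm_sub_le _ _).trans_eq ?_
    simp only [LinearIsometry.norm_map, norm_tensorState, hψ', hj, norm_graphState]
    norm_num
  · refine (norm_sub_le_norm_sub_add_norm_sub _ _ _).trans ((add_le_add h1 h2).trans ?_)
    have h3 := mul_le_mul_of_nonneg_right hq
      (by positivity : 0 ≤ (√2)⁻¹ * (4 * √(2 * ε)))
    refine (add_le_add_left h3 _).trans_eq ?_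
    -- The multiplier is 2 because `4 / √2 = 2√2` enters twice: from moving the flips through, and
    -- inside `η`.
    linear_combination 2 * (Fintype.card V : ℝ) * √(2 * ε) * hr
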